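/- Let $k$ be an infinite field, $S=k[x,y,z]$, and let $\mathcal A$ be a finite set of points of $\mathbf P^2=\mathbf P^2(k)$. Let $I_{\mathcal A}\subseteq S$ be the vanishing ideal of the union of the one-dimensional subspaces of $k^3$ corresponding to the points of $\mathcal A$. An ideal of $S$ is called pl-generated if it is generated by products of linear forms (the empty product $1$ being allowed). (1) If $\mathcal A$ is contained in a union of two lines, then $I_{\mathcal A}$ is pl-generated. (2) Let $L_1,L_2$ be nonzero linear forms defining two distinct lines whose union contains $\mathcal A$ and whose intersection point is not in $\mathcal A$. Let $p_1,\dots,p_{r_1}$ be the distinct points of $\mathcal A$ on the line $L_1=0$ and $q_1,\dots,q_{r_2}$ the distinct points of $\mathcal A$ on the line $L_2=0$, and suppose $r_1\ge r_2$. Then one can choose linear forms $h_1,\dots,h_{r_1}$ such that, for $i\le r_2$, $h_i$ defines the line joining $p_i$ to $q_i$, and, for $r_2<i\le r_1$, $h_i$ defines a line through $p_i$ different from the line $L_1=0$. For every such choice, $$I_{\mathcal A}=\bigl(L_1L_2,\; L_1h_1\cdots h_{r_2},\; h_1\cdots h_{r_1}\bigr),$$ and if $r_1=r_2$, then $I_{\mathcal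 A}=(L_1L_2,\;h_1\cdots h_{r_1})$. -/

import Mathlib

namespace PLGen

open MvPolynomial

/-- The projective plane over `k`: its points are the one-dimensional subspaces of `k³`. -/
abbrev Plane (k : Type*) [Field k] : Type _ := Projectivization k (Fin 3 → k)

/-- The cone `V_A ⊆ k³` of a set `A` of points: the union of the one-dimensional subspaces
that are the points of `A`. -/
def cone {k : Type*} [Field k] (A : Set (Plane k)) : Set (Fin 3 → k) :=
  ⋃ p ∈ A, (p.submodule : Set (Fin 3 → k))

/-- The ideal `I_A` of all polynomials in `k[x, y, z]` that vanish on the cone of `A`. -/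
noncomputable def idealOf {k : Type*} [Field k] (A : Set (Plane k)) :
    Ideal (MvPolynomial (Fin 3) k) :=
  vanishingIdeal k (cone A)

/-- The points of the plane at which the form `f` vanishes. -/
def zeros {k : Type*} [Field k] (f : MvPolynomial (Fin 3) k) : Set (Plane k) :=
  {p | ∀ v ∈ p.submodule, eval v f = 0}

/-- `f` is a nonzero linear form, that is, an equation of a line. -/
def IsLineEq {k : Type*} [Field k] (f : MvPolynomial (Fin 3) k) : Prop :=
  f.IsHomogeneous 1 ∧ f ≠ 0

/-- A line of the projective plane. -/
def IsLine {k : Type*} [Field k] (L : Set (Plane k)) : Prop :=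
  ∃ f : MvPolynomial (Fin 3) k, IsLineEq f ∧ L = zeros f

/-- `g` is a product of finitely many linear forms (the empty product is `1`). -/
def IsProdLinear {k : Type*} [Field k] (g : MvPolynomial (Fin 3) k) : Prop :=
  ∃ s : Multiset (MvPolynomial (Fin 3) k), (∀ f ∈ s, f.IsHomogeneous 1) ∧ g = s.prod

/-- An ideal is pl-generated if it is generated by products of linear forms. -/
def IsPLGenerated {k : Type*} [Field k] (I : Ideal (MvPolynomial (Fin 3) k)) : Prop :=
  ∃ G : Set (MvPolynomial (Fin 3) k), (∀ g ∈ G, IsProdLinear g) ∧ I = Ideal.span G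

/-- Given points `p_1, …, p_{r₁}` on the line `ℓ₁ = 0` and points `q_1, …, q_{r₂}`, `r₂ ≤ r₁`:
for `i ≤ r₂` the form `h_i` is an equation of the line joining `p_i` to `q_i`, and for `i > r₂`
it is an equation of a line through `p_i` other than `ℓ₁ = 0`. -/
structure IsJoinFamily {k : Type*} [Field k] (ℓ₁ : MvPolynomial (Fin 3) k) {r₁ r₂ : ℕ}
    (hr : r₂ ≤ r₁) (p : Fin r₁ → Plane k) (q : Fin r₂ → Plane k)
    (h : Fin r₁ → MvPolynomial (Fin 3) k) : Prop where
  isLineEq : ∀ i, IsLineEq (h i)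
  mem_left : ∀ i, p i ∈ zeros (h i)
  mem_right : ∀ i : Fin r₂, q i ∈ zeros (h (Fin.castLE hr i))
  ne_line : ∀ i : Fin r₁, r₂ ≤ (i : ℕ) → zeros (h i) ≠ zeros ℓ₁

end PLGen

/-!
The ideal of a point is prime, since `k` is infinite, and it is generated by the equations of any
two distinct lines through the point. If an ideal `J = (f, g)` contains `y` and `x` is a
nonzerodivisor modulo `J`, then `(x, y) ∩ J = (x f, x g, y)`. Adding one point at a time, this
shows that the ideal of points on a line `f = 0` is `(f, g₁ ⋯ gᵣ)`, where `gᵢ = 0` is any other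
line through the `i`-th point. Applied once more, with `J` the ideal of the points off the line
`f₁ = 0`, it gives `(f₁ f₂, f₁ h₁ ⋯ hₛ, g₁ ⋯ gᵣ)` for points on two lines, provided that
`g₁ ⋯ gᵣ` vanishes at the points off the first line.

This proviso can be met by joining lines as soon as there are at least as many points on the first
line as off it. After exchanging the two lines if necessary this is always so, even if the lines
coincide or their intersection is one of the points.
-/

namespace PLGen

open MvPolynomial

section CommRing

variable {R : Type*} [CommRing R]

theorem span_pair_inf_eq_span {J : Ideal R} {x y f g : R} (hJ : J = Ideal.span {f, g})
    (hy : y ∈ J) (hx : ∀ a, x * a ∈ J → a ∈ J) :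
    Ideal.span {x, y} ⊓ J = Ideal.span {x * f, x * g, y} := by
  apply le_antisymm
  · rintro u ⟨hu, huJ⟩
    obtain ⟨a, b, rfl⟩ := Ideal.mem_span_pair.1 hu
    have hxa : x * a ∈ J := by
      rw [mul_comm]
      exact (J.add_mem_iff_left (J.mul_mem_left b hy)).1 huJ
    obtain ⟨c, d, rfl⟩ := Ideal.mem_span_pair.1 (hJ ▸ hx a hxa)
    refine Submodule.mem_span_triple.2 ⟨c, d, b, ?_⟩
    simp only [smul_eq_mul]
    ring
  · have hfJ : f ∈ J := hJ ▸ Ideal.mem_span_pair.2 ⟨1, 0, by ring⟩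
    have hgJ : g ∈ J := hJ ▸ Ideal.mem_span_pair.2 ⟨0, 1, by ring⟩
    rw [Ideal.span_le]
    rintro u (rfl | rfl | rfl)
    · exact ⟨Ideal.mem_span_pair.2 ⟨f, 0, by ring⟩, J.mul_mem_left x hfJ⟩
    · exact ⟨Ideal.mem_span_pair.2 ⟨g, 0, by ring⟩, J.mul_mem_left x hgJ⟩
    · exact ⟨Ideal.mem_span_pair.2 ⟨0, 1, by ring⟩, hy⟩

variable {σ : Type*}

/-- The linear form with a given coefficient vector. -/
noncomputable def linearForm [Fintype σ] : (σ → R) →ₗ[R] MvPolynomial σ R :=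
  Fintype.linearCombination R X

theorem linearForm_single [Fintype σ] [DecidableEq σ] (i : σ) :
    linearForm (Pi.single i (1 : R)) = X i := by
  rw [linearForm, Fintype.linearCombination_apply_single, one_smul]

theorem eval_linearForm [Fintype σ] (a v : σ → R) : eval v (linearForm a) = a ⬝ᵥ v := by
  simp [linearForm, Fintype.linearCombination_apply, dotProduct, smul_eval]

theorem range_linearForm [Fintype σ] :
    LinearMap.range (linearForm (R := R) (σ := σ)) = homogeneousSubmodule σ R 1 := by
  rw [homogeneousSubmodule_one_eq_span_X, linearForm, Fintype.range_linearCombination]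

/-- The restriction of polynomial functions to the line `t ↦ t • v`, as polynomials in `t`. -/
noncomputable def restrictLine (v : σ → R) : MvPolynomial σ R →ₐ[R] Polynomial R :=
  aeval fun i => Polynomial.C (v i) * Polynomial.X

theorem eval_restrictLine (v : σ → R) (t : R) (f : MvPolynomial σ R) :
    (restrictLine v f).eval t = eval (t • v) f := by
  have h : (Polynomial.aeval t).comp (restrictLine v) = aeval (t • v) := by
    ext i
    simp [restrictLine, mul_comm t]
  simpa [Polynomial.coe_aeval_eq_eval, coe_aeval_eq_eval] using DFunLike.congr_fun h f

theorem restrictLine_linearForm [Fintype σ] (a v : σ → R) :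
    restrictLine v (linearForm a) = Polynomial.C (a ⬝ᵥ v) * Polynomial.X := by
  simp [restrictLine, linearForm, Fintype.linearCombination_apply, dotProduct, Finset.sum_mul,
    Polynomial.smul_eq_C_mul, mul_assoc]

theorem ker_restrictLine [Fintype σ] {v w : σ → R} (hwv : w ⬝ᵥ v = 1) :
    RingHom.ker (restrictLine v) = Ideal.span (linearForm '' {a | a ⬝ᵥ v = 0}) := by
  classical
  set I := Ideal.span (linearForm '' {a | a ⬝ᵥ v = 0}) with hI
  apply le_antisymm
  · -- Modulo `I` every `X j` is `v j` times `linearForm w`.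
    have hfactor : Ideal.Quotient.mkₐ R I =
        (Polynomial.aeval (Ideal.Quotient.mkₐ R I (linearForm w))).comp (restrictLine v) := by
      ext j
      have hmem : X j - v j • linearForm w ∈ I := by
        rw [← linearForm_single, ← map_smul, ← map_sub]
        refine Ideal.subset_span ⟨_, ?_, rfl⟩
        simp [sub_dotProduct, hwv]
      calc Ideal.Quotient.mkₐ R I (X j) = Ideal.Quotient.mkₐ R I (v j • linearForm w) :=
            Ideal.Quotient.eq.2 hmem
        _ = Polynomial.aeval (Ideal.Quotient.mkₐ R I (linearForm w)) (restrictLine v (X j)) := by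
            rw [restrictLine, aeval_X, map_mul, Polynomial.aeval_C, Polynomial.aeval_X, map_smul]
            exact Algebra.smul_def (v j) (Ideal.Quotient.mkₐ R I (linearForm w))
    intro u hu
    rw [RingHom.mem_ker] at hu
    have hmk := DFunLike.congr_fun hfactor u
    rw [AlgHom.comp_apply, hu, map_zero] at hmk
    exact Ideal.Quotient.eq_zero_iff_mem.1 hmk
  · rw [hI, Ideal.span_le]
    rintro _ ⟨a, ha, rfl⟩
    rw [SetLike.mem_coe, RingHom.mem_ker, restrictLine_linearForm, ha, map_zero, zero_mul]

end CommRing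

variable {k : Type*} [Field k]

theorem vanishingIdeal_span_singleton [Infinite k] {σ : Type*} (v : σ → k) :
    vanishingIdeal k (k ∙ v : Set (σ → k)) = RingHom.ker (restrictLine v) := by
  ext f
  calc f ∈ vanishingIdeal k (k ∙ v : Set (σ → k)) ↔ ∀ t : k, (restrictLine v f).eval t = 0 := by
        simp [Submodule.mem_span_singleton, aeval_eq_eval, eval_restrictLine]
    _ ↔ f ∈ RingHom.ker (restrictLine v) :=
        ⟨Polynomial.zero_of_eval_zero _, fun hf t => by
          rw [RingHom.mem_ker.1 hf, Polynomial.eval_zero]⟩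

theorem mem_span_pair_of_dotProduct_eq_zero {a b c v : Fin 3 → k}
    (hab : LinearIndependent k ![a, b]) (hv : v ≠ 0) (ha : a ⬝ᵥ v = 0) (hb : b ⬝ᵥ v = 0)
    (hc : c ⬝ᵥ v = 0) : c ∈ Submodule.span k {a, b} := by
  set φ : Module.Dual k (Fin 3 → k) := dotProductEquiv k (Fin 3) v with hφ
  have mem_ker (w : Fin 3 → k) : w ∈ LinearMap.ker φ ↔ w ⬝ᵥ v = 0 := by
    simp [hφ, dotProduct_comm]
  have hle : Submodule.span k {a, b} ≤ LinearMap.ker φ := by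
    rw [Submodule.span_le]
    rintro _ (rfl | rfl)
    exacts [(mem_ker _).2 ha, (mem_ker _).2 hb]
  have hker : Module.finrank k (LinearMap.ker φ) + 1 = 3 := by
    rw [Module.Dual.finrank_ker_add_one_of_ne_zero (by simpa [hφ] using hv),
      Module.finrank_fin_fun]
  have hspan : Module.finrank k (Submodule.span k {a, b}) = 2 := by
    rw [← Matrix.range_cons_cons_empty a b ![], finrank_span_eq_card hab, Fintype.card_fin]
  rw [Submodule.eq_of_le_of_finrank_eq hle (by lia), mem_ker]
  exact hc

section Zeros

variable {f g : MvPolynomial (Fin 3) k} {p q : Plane k} {A : Set (Plane k)}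

theorem mem_idealOf : f ∈ idealOf A ↔ A ⊆ zeros f := by
  simp only [idealOf, cone, mem_vanishingIdeal_iff, Set.mem_iUnion]
  exact ⟨fun h p hp v hv => h v ⟨p, hp, hv⟩, fun h v ⟨p, hp, hv⟩ => h hp v hv⟩

theorem mem_idealOf_singleton : f ∈ idealOf {p} ↔ p ∈ zeros f := by
  rw [mem_idealOf, Set.singleton_subset_iff]

theorem idealOf_union (A B : Set (Plane k)) : idealOf (A ∪ B) = idealOf A ⊓ idealOf B := by
  ext f
  simp only [Ideal.mem_inf, mem_idealOf, Set.union_subset_iff]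

theorem idealOf_singleton_mk [Infinite k] {v : Fin 3 → k} (hv : v ≠ 0) :
    idealOf {Projectivization.mk k v hv} = RingHom.ker (restrictLine v) := by
  rw [← vanishingIdeal_span_singleton, idealOf, cone, Set.biUnion_singleton,
    Projectivization.submodule_mk]

instance isPrime_idealOf_singleton [Infinite k] (p : Plane k) : (idealOf {p}).IsPrime := by
  induction p using Projectivization.ind with
  | h v hv => exact idealOf_singleton_mk hv ▸ RingHom.ker_isPrime _

theorem mem_zeros_mul [Infinite k] : p ∈ zeros (f * g) ↔ p ∈ zeros f ∨ p ∈ zeros g := by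
  simp only [← mem_idealOf_singleton, Ideal.IsPrime.mul_mem_iff_mem_or_mem]

theorem mem_zeros_prod [Infinite k] {ι : Type*} {s : Finset ι}
    {h : ι → MvPolynomial (Fin 3) k} : p ∈ zeros (∏ i ∈ s, h i) ↔ ∃ i ∈ s, p ∈ zeros (h i) := by
  simp only [← mem_idealOf_singleton, Ideal.IsPrime.prod_mem_iff]

theorem mem_idealOf_of_mul_mem [Infinite k] (hf : ∀ p ∈ A, p ∉ zeros f)
    (hfg : f * g ∈ idealOf A) : g ∈ idealOf A :=
  mem_idealOf.2 fun p hp =>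
    (mem_zeros_mul.1 (mem_idealOf.1 hfg hp)).resolve_left (hf p hp)

theorem mem_zeros_linearForm {a : Fin 3 → k} (ha : a ≠ 0) :
    p ∈ zeros (linearForm a) ↔ (Projectivization.mk k a ha).orthogonal p := by
  induction p using Projectivization.ind with
  | h v hv =>
    simp only [zeros, Set.mem_ofPred_eq, Projectivization.submodule_mk,
      Submodule.mem_span_singleton, forall_exists_index, forall_apply_eq_imp_iff,
      eval_linearForm, dotProduct_smul, Projectivization.orthogonal_mk]
    exact ⟨fun h => by simpa using h 1, fun h t => by rw [h, smul_zero]⟩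

end Zeros

section Lines

variable {f g : MvPolynomial (Fin 3) k} {p q : Plane k}

theorem isLineEq_linearForm {a : Fin 3 → k} (ha : a ≠ 0) : IsLineEq (linearForm a) := by
  refine ⟨(mem_homogeneousSubmodule ..).1 (range_linearForm.le ⟨a, rfl⟩), fun h => ha ?_⟩
  exact dotProduct_eq_zero_iff.1 fun v => by rw [← eval_linearForm, h, map_zero]

theorem IsLineEq.exists_eq_linearForm (hf : IsLineEq f) : ∃ a ≠ 0, linearForm a = f := by
  obtain ⟨a, rfl⟩ := range_linearForm.ge hf.1
  exact ⟨a, fun ha => hf.2 (by rw [ha, map_zero]), rfl⟩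

theorem mk_ne_mk_of_zeros_ne {a b : Fin 3 → k} (ha : a ≠ 0) (hb : b ≠ 0)
    (hab : zeros (linearForm a) ≠ zeros (linearForm b)) :
    Projectivization.mk k a ha ≠ Projectivization.mk k b hb := fun h =>
  hab (Set.ext fun p => by rw [mem_zeros_linearForm ha, h, mem_zeros_linearForm hb])

theorem IsLineEq.eq_of_mem_zeros (hf : IsLineEq f) (hg : IsLineEq g)
    (hfg : zeros f ≠ zeros g) (hpf : p ∈ zeros f) (hpg : p ∈ zeros g) (hqf : q ∈ zeros f)
    (hqg : q ∈ zeros g) : p = q := by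
  obtain ⟨a, ha, rfl⟩ := hf.exists_eq_linearForm
  obtain ⟨b, hb, rfl⟩ := hg.exists_eq_linearForm
  rw [mem_zeros_linearForm ha] at hpf hqf
  rw [mem_zeros_linearForm hb] at hpg hqg
  exact (Configuration.ofField.eq_or_eq_of_orthogonal hpf hpg hqf hqg).resolve_left
    (mk_ne_mk_of_zeros_ne ha hb hfg)

theorem idealOf_singleton_eq_span [Infinite k] (hf : IsLineEq f) (hg : IsLineEq g)
    (hfg : zeros f ≠ zeros g) (hpf : p ∈ zeros f) (hpg : p ∈ zeros g) :
    idealOf {p} = Ideal.span {f, g} := by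
  apply le_antisymm
  · obtain ⟨a, ha, rfl⟩ := hf.exists_eq_linearForm
    obtain ⟨b, hb, rfl⟩ := hg.exists_eq_linearForm
    have hab : LinearIndependent k ![a, b] := by
      rw [← crossProduct_ne_zero_iff_linearIndependent, Ne,
        ← Projectivization.mk_eq_mk_iff_crossProduct_eq_zero ha hb]
      exact mk_ne_mk_of_zeros_ne ha hb hfg
    induction p using Projectivization.ind with
    | h v hv =>
      rw [mem_zeros_linearForm ha, Projectivization.orthogonal_mk] at hpf
      rw [mem_zeros_linearForm hb, Projectivization.orthogonal_mk] at hpg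
      obtain ⟨i, hi⟩ := Function.ne_iff.1 hv
      have hw : Pi.single i (v i)⁻¹ ⬝ᵥ v = 1 := by
        rw [single_dotProduct, inv_mul_cancel₀ hi]
      rw [idealOf_singleton_mk hv, ker_restrictLine hw, Ideal.span_le]
      rintro _ ⟨c, hc, rfl⟩
      obtain ⟨s, t, rfl⟩ := Submodule.mem_span_pair.1
        (mem_span_pair_of_dotProduct_eq_zero hab hv hpf hpg hc)
      refine Ideal.mem_span_pair.2 ⟨C s, C t, ?_⟩
      rw [map_add, map_smul, map_smul, smul_eq_C_mul, smul_eq_C_mul]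
  · rw [Ideal.span_le]
    rintro _ (rfl | rfl)
    exacts [mem_idealOf_singleton.2 hpf, mem_idealOf_singleton.2 hpg]

theorem exists_isLineEq_through (p q : Plane k) :
    ∃ f : MvPolynomial (Fin 3) k, IsLineEq f ∧ p ∈ zeros f ∧ q ∈ zeros f := by
  have hker : LinearMap.ker (Matrix.of ![p.rep, q.rep]).mulVecLin ≠ ⊥ :=
    LinearMap.ker_ne_bot_of_finrank_lt (by simp)
  obtain ⟨a, hpq, ha⟩ := Submodule.exists_mem_ne_zero_of_ne_bot hker
  refine ⟨linearForm a, isLineEq_linearForm ha, ?_, ?_⟩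
  · rw [mem_zeros_linearForm ha, ← p.mk_rep, Projectivization.orthogonal_comm]
    exact congrFun hpq 0
  · rw [mem_zeros_linearForm ha, ← q.mk_rep, Projectivization.orthogonal_comm]
    exact congrFun hpq 1

theorem IsLineEq.exists_through_ne (hf : IsLineEq f) (p : Plane k) :
    ∃ g, IsLineEq g ∧ p ∈ zeros g ∧ zeros g ≠ zeros f := by
  obtain ⟨a, ha, rfl⟩ := hf.exists_eq_linearForm
  obtain ⟨q, hq⟩ := (Projectivization.mk k a ha).exists_not_self_orthogonal
  obtain ⟨g, hg, hpg, hqg⟩ := exists_isLineEq_through p q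
  exact ⟨g, hg, hpg, fun h => hq ((mem_zeros_linearForm ha).1 (h ▸ hqg))⟩

end Lines

section Transversal

/-- The forms `g i` are equations of lines, distinct from the line `f = 0`, through the points
`p i` of that line. -/
structure IsTransversalFamily {ι : Type*} (f : MvPolynomial (Fin 3) k) (p : ι → Plane k)
    (g : ι → MvPolynomial (Fin 3) k) : Prop where
  mem_line : ∀ i, p i ∈ zeros f
  isLineEq : ∀ i, IsLineEq (g i)
  mem : ∀ i, p i ∈ zeros (g i)
  ne_line : ∀ i, zeros (g i) ≠ zeros f

variable {ι κ : Type*} {f : MvPolynomial (Fin 3) k} {p : ι → Plane k}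
  {g : ι → MvPolynomial (Fin 3) k}

theorem exists_isTransversalFamily (hf : IsLineEq f) (hp : ∀ i, p i ∈ zeros f) :
    ∃ g, IsTransversalFamily f p g := by
  choose g hg hpg hgf using fun i => hf.exists_through_ne (p i)
  exact ⟨g, hp, hg, hpg, hgf⟩

theorem IsTransversalFamily.eq_of_mem_zeros (hg : IsTransversalFamily f p g) (hf : IsLineEq f)
    {i j : ι} (hij : p i ∈ zeros (g j)) : p i = p j :=
  hf.eq_of_mem_zeros (hg.isLineEq j) (hg.ne_line j).symm (hg.mem_line i) hij (hg.mem_line j)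
    (hg.mem j)

theorem IsTransversalFamily.idealOf_image_eq_span [Infinite k]
    (hg : IsTransversalFamily f p g) (hf : IsLineEq f) (hp : Function.Injective p)
    (s : Finset ι) : idealOf (p '' s) = Ideal.span {f, ∏ i ∈ s, g i} := by
  classical
  induction s using Finset.induction_on with
  | empty =>
    have hspan : Ideal.span {f, 1} = ⊤ := (Ideal.eq_top_iff_one _).2 (Ideal.subset_span (by simp))
    rw [Finset.coe_empty, Set.image_empty, Finset.prod_empty, hspan, Ideal.eq_top_iff_one]
    exact mem_idealOf.2 (Set.empty_subset _)
  | insert i s his ih =>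
    have hi : idealOf {p i} = Ideal.span {f, g i} :=
      idealOf_singleton_eq_span hf (hg.isLineEq i) (hg.ne_line i).symm (hg.mem_line i) (hg.mem i)
    have hprod : p i ∉ zeros (∏ j ∈ s, g j) := fun h => by
      obtain ⟨j, hj, hij⟩ := mem_zeros_prod.1 h
      exact his (hp (hg.eq_of_mem_zeros hf hij) ▸ hj)
    rw [Finset.coe_insert, Set.image_insert_eq, Set.insert_eq, Set.union_comm, idealOf_union, ih,
      Set.pair_comm, span_pair_inf_eq_span hi (mem_idealOf_singleton.2 (hg.mem_line i))
        fun a => mem_idealOf_of_mul_mem (by simpa using hprod)]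
    rw [Finset.prod_insert his, mul_comm (g i), Set.pair_comm]
    exact Submodule.span_insert_eq_span
      (Ideal.mul_mem_left _ _ (Ideal.subset_span (by simp)))

theorem IsTransversalFamily.idealOf_range_eq_span [Infinite k] [Fintype ι]
    (hg : IsTransversalFamily f p g) (hf : IsLineEq f) (hp : Function.Injective p) :
    idealOf (Set.range p) = Ideal.span {f, ∏ i, g i} := by
  rw [← hg.idealOf_image_eq_span hf hp, Finset.coe_univ, Set.image_univ]

theorem IsTransversalFamily.idealOf_union_eq_span [Infinite k] [Fintype ι] [Fintype κ]
    {f₁ f₂ : MvPolynomial (Fin 3) k} {q : κ → Plane k} {h : κ → MvPolynomial (Fin 3) k}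
    (hg : IsTransversalFamily f₁ p g) (hh : IsTransversalFamily f₂ q h) (hf₁ : IsLineEq f₁)
    (hf₂ : IsLineEq f₂) (hp : Function.Injective p) (hq : Function.Injective q)
    (hqf : ∀ j, q j ∉ zeros f₁) (hqg : ∀ j, q j ∈ zeros (∏ i, g i)) :
    idealOf (Set.range p ∪ Set.range q) = Ideal.span {f₁ * f₂, f₁ * ∏ j, h j, ∏ i, g i} := by
  rw [idealOf_union, hg.idealOf_range_eq_span hf₁ hp]
  exact span_pair_inf_eq_span (hh.idealOf_range_eq_span hf₂ hq)
    (mem_idealOf.2 (Set.range_subset_iff.2 hqg))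
    fun a => mem_idealOf_of_mul_mem (Set.forall_mem_range.2 hqf)

end Transversal

section JoinFamily

variable {ℓ₁ ℓ₂ : MvPolynomial (Fin 3) k} {r₁ r₂ : ℕ} {hr : r₂ ≤ r₁} {p : Fin r₁ → Plane k}
  {q : Fin r₂ → Plane k} {h : Fin r₁ → MvPolynomial (Fin 3) k}

theorem exists_isJoinFamily (hℓ₁ : IsLineEq ℓ₁) (hr : r₂ ≤ r₁) (p : Fin r₁ → Plane k)
    (q : Fin r₂ → Plane k) : ∃ h, IsJoinFamily ℓ₁ hr p q h := by
  choose g hg hpg hqg using fun i : Fin r₂ => exists_isLineEq_through (p (i.castLE hr)) (q i)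
  choose h hh hph hne using fun i => hℓ₁.exists_through_ne (p i)
  refine ⟨fun i => if hi : (i : ℕ) < r₂ then g ⟨i, hi⟩ else h i, ?_, ?_, ?_, ?_⟩
  · intro i
    split_ifs with hi
    exacts [hg _, hh i]
  · intro i
    split_ifs with hi
    exacts [hpg ⟨i, hi⟩, hph i]
  · intro i
    simpa using hqg i
  · intro i hi
    simpa [hi.not_gt] using hne i

theorem IsJoinFamily.isTransversalFamily (hh : IsJoinFamily ℓ₁ hr p q h)
    (hp : ∀ i, p i ∈ zeros ℓ₁) (hq : ∀ j, q j ∉ zeros ℓ₁) : IsTransversalFamily ℓ₁ p h where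
  mem_line := hp
  isLineEq := hh.isLineEq
  mem := hh.mem_left
  ne_line i heq := by
    rcases lt_or_ge (i : ℕ) r₂ with hi | hi
    · exact hq ⟨i, hi⟩ (heq ▸ hh.mem_right ⟨i, hi⟩)
    · exact hh.ne_line i hi heq

theorem IsJoinFamily.isTransversalFamily_castLE (hh : IsJoinFamily ℓ₁ hr p q h)
    (hp : ∀ i, p i ∉ zeros ℓ₂) (hq : ∀ j, q j ∈ zeros ℓ₂) :
    IsTransversalFamily ℓ₂ q fun j => h (j.castLE hr) where
  mem_line := hq
  isLineEq _ := hh.isLineEq _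
  mem := hh.mem_right
  ne_line j heq := hp (j.castLE hr) (heq ▸ hh.mem_left _)

theorem IsJoinFamily.mem_zeros_prod [Infinite k] (hh : IsJoinFamily ℓ₁ hr p q h) (j : Fin r₂) :
    q j ∈ zeros (∏ i, h i) :=
  PLGen.mem_zeros_prod.2 ⟨_, Finset.mem_univ _, hh.mem_right j⟩

theorem IsJoinFamily.idealOf_eq_span [Infinite k] {A : Set (Plane k)}
    (hh : IsJoinFamily ℓ₁ hr p q h) (hℓ₁ : IsLineEq ℓ₁) (hℓ₂ : IsLineEq ℓ₂)
    (hA : A ⊆ zeros ℓ₁ ∪ zeros ℓ₂) (hx : ∀ x ∈ zeros ℓ₁ ∩ zeros ℓ₂, x ∉ A)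
    (hp : Function.Injective p) (hq : Function.Injective q) (hpA : Set.range p = A ∩ zeros ℓ₁)
    (hqA : Set.range q = A ∩ zeros ℓ₂) :
    idealOf A = Ideal.span {ℓ₁ * ℓ₂, ℓ₁ * ∏ j : Fin r₂, h (j.castLE hr), ∏ i, h i} := by
  have hpA' i : p i ∈ A ∩ zeros ℓ₁ := hpA ▸ Set.mem_range_self i
  have hqA' j : q j ∈ A ∩ zeros ℓ₂ := hqA ▸ Set.mem_range_self j
  have hpℓ₂ i : p i ∉ zeros ℓ₂ := fun hi => hx _ ⟨(hpA' i).2, hi⟩ (hpA' i).1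
  have hqℓ₁ j : q j ∉ zeros ℓ₁ := fun hj => hx _ ⟨hj, (hqA' j).2⟩ (hqA' j).1
  have hApq : A = Set.range p ∪ Set.range q := by
    rw [hpA, hqA, ← Set.inter_union_distrib_left, Set.inter_eq_left.2 hA]
  rw [hApq]
  exact (hh.isTransversalFamily (fun i => (hpA' i).2) hqℓ₁).idealOf_union_eq_span
    (hh.isTransversalFamily_castLE hpℓ₂ fun j => (hqA' j).2) hℓ₁ hℓ₂ hp hq hqℓ₁ hh.mem_zeros_prod

end JoinFamily

section PLGenerated

theorem isProdLinear_iff_mem_closure {f : MvPolynomial (Fin 3) k} :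
    IsProdLinear f ↔ f ∈ Submonoid.closure {l : MvPolynomial (Fin 3) k | l.IsHomogeneous 1} := by
  constructor
  · rintro ⟨s, hs, rfl⟩
    exact Submonoid.multiset_prod_mem _ _ fun l hl => Submonoid.subset_closure (hs l hl)
  · intro hf
    obtain ⟨s, hs, hprod⟩ := Submonoid.exists_multiset_of_mem_closure hf
    exact ⟨s, hs, hprod.symm⟩

theorem isPLGenerated_span_triple {ι κ : Type*} [Fintype ι] [Fintype κ]
    {f₁ f₂ : MvPolynomial (Fin 3) k} {g : ι → MvPolynomial (Fin 3) k}
    {h : κ → MvPolynomial (Fin 3) k} (hf₁ : f₁.IsHomogeneous 1) (hf₂ : f₂.IsHomogeneous 1)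
    (hg : ∀ i, (g i).IsHomogeneous 1) (hh : ∀ j, (h j).IsHomogeneous 1) :
    IsPLGenerated (Ideal.span {f₁ * f₂, f₁ * ∏ j, h j, ∏ i, g i}) := by
  refine ⟨_, fun u hu => isProdLinear_iff_mem_closure.2 ?_, rfl⟩
  have mem_closure {l : MvPolynomial (Fin 3) k} (hl : l.IsHomogeneous 1) :
      l ∈ Submonoid.closure {l : MvPolynomial (Fin 3) k | l.IsHomogeneous 1} :=
    Submonoid.subset_closure hl
  rcases hu with rfl | rfl | rfl
  · exact mul_mem (mem_closure hf₁) (mem_closure hf₂)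
  · exact mul_mem (mem_closure hf₁) (prod_mem fun j _ => mem_closure (hh j))
  · exact prod_mem fun i _ => mem_closure (hg i)

theorem exists_injective_fin_ncard_range_eq {α : Type*} {A : Set α} (hA : A.Finite) :
    ∃ p : Fin A.ncard → α, Function.Injective p ∧ Set.range p = A := by
  have := hA.to_subtype
  let e : Fin A.ncard ≃ A := (Finite.equivFin A).symm
  refine ⟨fun i => e i, Subtype.val_injective.comp e.injective, ?_⟩
  rw [← Function.comp_def, e.surjective.range_comp, Subtype.range_val]

variable [Infinite k] {A : Set (Plane k)} {f₁ f₂ : MvPolynomial (Fin 3) k}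

theorem isPLGenerated_idealOf_of_ncard_le (hA : A.Finite) (hf₁ : IsLineEq f₁)
    (hf₂ : IsLineEq f₂) (hAf : A ⊆ zeros f₁ ∪ zeros f₂)
    (hcard : (A \ zeros f₁).ncard ≤ (A ∩ zeros f₁).ncard) : IsPLGenerated (idealOf A) := by
  obtain ⟨p, hp, hpA⟩ := exists_injective_fin_ncard_range_eq (hA.inter_of_left (zeros f₁))
  obtain ⟨q, hq, hqA⟩ := exists_injective_fin_ncard_range_eq (hA.sdiff (t := zeros f₁))
  have hpf₁ i : p i ∈ zeros f₁ := (hpA ▸ Set.mem_range_self i : p i ∈ A ∩ zeros f₁).2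
  have hqA' j : q j ∈ A \ zeros f₁ := hqA ▸ Set.mem_range_self j
  have hqf₂ j : q j ∈ zeros f₂ := (hAf (hqA' j).1).resolve_left (hqA' j).2
  obtain ⟨g, hg⟩ := exists_isJoinFamily hf₁ hcard p q
  obtain ⟨h, hh⟩ := exists_isTransversalFamily hf₂ hqf₂
  have hg' := hg.isTransversalFamily hpf₁ fun j => (hqA' j).2
  rw [← Set.inter_union_sdiff A (zeros f₁), ← hpA, ← hqA, hg'.idealOf_union_eq_span hh hf₁ hf₂ hp hq
    (fun j => (hqA' j).2) hg.mem_zeros_prod]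
  exact isPLGenerated_span_triple hf₁.1 hf₂.1 (fun i => (hg.isLineEq i).1)
    fun j => (hh.isLineEq j).1

theorem isPLGenerated_idealOf (hA : A.Finite) (hf₁ : IsLineEq f₁) (hf₂ : IsLineEq f₂)
    (hAf : A ⊆ zeros f₁ ∪ zeros f₂) : IsPLGenerated (idealOf A) := by
  rcases le_total (A \ zeros f₁).ncard (A ∩ zeros f₁).ncard with hcard | hcard
  · exact isPLGenerated_idealOf_of_ncard_le hA hf₁ hf₂ hAf hcard
  · rw [Set.union_comm] at hAf
    refine isPLGenerated_idealOf_of_ncard_le hA hf₂ hf₁ hAf ?_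
    calc (A \ zeros f₂).ncard ≤ (A ∩ zeros f₁).ncard := Set.ncard_le_ncard ?_ (hA.inter_of_left _)
      _ ≤ (A \ zeros f₁).ncard := hcard
      _ ≤ (A ∩ zeros f₂).ncard := Set.ncard_le_ncard ?_ (hA.inter_of_left _)
    · exact fun x hx => ⟨hx.1, (hAf hx.1).resolve_left hx.2⟩
    · exact fun x hx => ⟨hx.1, (hAf hx.1).resolve_right hx.2⟩

end PLGenerated

end PLGen

theorem mainTheorem7 {k : Type*} [Field k] [Infinite k] (A : Set (PLGen.Plane k))
    (hA : A.Finite) :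
    (∀ L₁ L₂ : Set (PLGen.Plane k), PLGen.IsLine L₁ → PLGen.IsLine L₂ → A ⊆ L₁ ∪ L₂ →
      PLGen.IsPLGenerated (PLGen.idealOf A)) ∧
    (∀ ℓ₁ ℓ₂ : MvPolynomial (Fin 3) k, PLGen.IsLineEq ℓ₁ → PLGen.IsLineEq ℓ₂ →
      PLGen.zeros ℓ₁ ≠ PLGen.zeros ℓ₂ → A ⊆ PLGen.zeros ℓ₁ ∪ PLGen.zeros ℓ₂ →
      (∀ x ∈ PLGen.zeros ℓ₁ ∩ PLGen.zeros ℓ₂, x ∉ A) →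
      ∀ (r₁ r₂ : ℕ) (hr : r₂ ≤ r₁) (p : Fin r₁ → PLGen.Plane k) (q : Fin r₂ → PLGen.Plane k),
        Function.Injective p → Function.Injective q →
        Set.range p = A ∩ PLGen.zeros ℓ₁ → Set.range q = A ∩ PLGen.zeros ℓ₂ →
        (∃ h : Fin r₁ → MvPolynomial (Fin 3) k, PLGen.IsJoinFamily ℓ₁ hr p q h) ∧
        ∀ h : Fin r₁ → MvPolynomial (Fin 3) k, PLGen.IsJoinFamily ℓ₁ hr p q h →
          PLGen.idealOf A =
            Ideal.span {ℓ₁ * ℓ₂, ℓ₁ * ∏ i : Fin r₂, h (Fin.castLE hr i), ∏ i, h i} ∧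
          (r₁ = r₂ → PLGen.idealOf A = Ideal.span {ℓ₁ * ℓ₂, ∏ i, h i})) := by
  refine ⟨?_, ?_⟩
  · rintro _ _ ⟨ℓ₁, hℓ₁, rfl⟩ ⟨ℓ₂, hℓ₂, rfl⟩ hAℓ
    exact PLGen.isPLGenerated_idealOf hA hℓ₁ hℓ₂ hAℓ
  · intro ℓ₁ ℓ₂ hℓ₁ hℓ₂ _ hAℓ hx r₁ r₂ hr p q hp hq hpA hqA
    refine ⟨PLGen.exists_isJoinFamily hℓ₁ hr p q, fun h hh => ?_⟩
    have hspan := hh.idealOf_eq_span hℓ₁ hℓ₂ hAℓ hx hp hq hpA hqA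
    refine ⟨hspan, ?_⟩
    rintro rfl
    rw [hspan, Set.insert_comm]
    exact Submodule.span_insert_eq_span (Ideal.mul_mem_left _ _ (Ideal.subset_span (by simp)))
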